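/- **Theorem 4 (Infinity is at most three).** *Setting.* An ADMG is a finite graph with directed edges $\to$ and bidirected edges $\leftrightarrow$ (the latter joining distinct vertices) that has no directed cycle. A cluster graph $\mathcal G^C$ is a mixed graph, possibly with self-loops and cycles, on a finite set $\mathcal V^C$ of clusters, in which every cluster $V$ carries a cardinality $\#V\ge 1$ and stands for micro-variables $V_1,\dots,V_{\#V}$. For a set $\mathcal S^C$ of clusters, $\mathcal S^m$ denotes the set of all micro-variables of its clusters. An ADMG $\mathcal G^m$ on all the micro-variables is *compatible* with $\mathcal G^C$ if for all clusters $V,W$ (possibly equal), $V\to W$ (resp. $V\leftrightarrow W$) is an edge of $\mathcal G^C$ if and only if $V_v\to W_w$ (resp. $V_v\leftrightarrow W_w$) is an edge of $\mathcal G^m$ for some $v,w$. Let $\mathcal C(\mathcal G^C)$ be the set of these graphs; $\mathcal G^C$ is a *C-DAG* if $\mathcal C(\mathcal G^C)\neq\emptyset$. Let $\mathcal G^C_{\le 3}$ be the cluster graph with the same clusters and the same edges as $\mathcal G^C$ in which each cluster $V$ has cardinality $\min(\#V,3)$, and write $\mathcal S^m_{\le 3}$ for the set of its micro-variables that lie in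 the clusters of $\mathcal S^C$. For a mixed graph $\mathcal G$ and vertex sets $\mathcal A,\mathcal B$, let $\mathcal G_{\overline{\mathcal A}\,\underline{\mathcal B}}$ be obtained from $\mathcal G$ by removing all edges with an arrowhead into $\mathcal A$ and all directed edges with tail in $\mathcal B$. A path (no repeated vertices) is active given $\mathcal Z$ if each collider on it has a descendant (possibly itself) in $\mathcal Z$ and no non-collider on it, endpoints included, is in $\mathcal Z$; $\mathcal X\perp_{\mathcal G}\mathcal Y\mid\mathcal Z$ means that no path between $\mathcal X$ and $\mathcal Y$ in $\mathcal G$ is active given $\mathcal Z$. We say that $R_i(\mathcal W,\mathcal X,\mathcal Y,\mathcal Z)$ (the $i$-th rule of Pearl's do-calculus) *holds in* $\mathcal G$ if - $i=1$: $\mathcal Y\perp_{\mathcal G_{\overline{\mathcal W}}}\mathcal X\mid\mathcal W\cup\mathcal Z$; - $i=2$: $\mathcal Y\perp_{\mathcal G_{\overline{\mathcal W}\,\underline{\mathcal X}}}\mathcal X\mid\mathcal W\cup\mathcal Z$; - $i=3$: $\mathcal Y\perp_{\mathcal G_{\overline{\mathcal W\cup\mathcal X(\mathcal Z)}}}\mathcal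 X\mid\mathcal W\cup\mathcal Z$, where $\mathcal X(\mathcal Z)$ is the set of elements of $\mathcal X$ that are not ancestors of (or in) $\mathcal Z$ in $\mathcal G_{\overline{\mathcal W}}$. *Statement.* Let $\mathcal G^C$ be a C-DAG, let $\mathcal W^C,\mathcal X^C,\mathcal Y^C,\mathcal Z^C$ be pairwise disjoint sets of clusters, and let $i\in\{1,2,3\}$. The following are equivalent: 1. There exists $\mathcal G^m\in\mathcal C(\mathcal G^C)$ in which $R_i(\mathcal W^m,\mathcal X^m,\mathcal Y^m,\mathcal Z^m)$ does not hold. 2. There exists $\mathcal G^m_{\le 3}\in\mathcal C(\mathcal G^C_{\le 3})$ in which $R_i(\mathcal W^m_{\le 3},\mathcal X^m_{\le 3},\mathcal Y^m_{\le 3},\mathcal Z^m_{\le 3})$ does not hold. -/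

import Mathlib

/-! Mixed graphs, d-separation, mutilated graphs, and cluster-DAGs. -/

/-- A mixed graph on the vertex set `V`: directed edges `u → v` and bidirected edges `u ↔ v`. -/
structure MixedGraph (V : Type*) where
  /-- `dir u v`: there is a directed edge `u → v`. -/
  dir : V → V → Prop
  /-- `bi u v`: there is a bidirected edge `u ↔ v`. -/
  bi : V → V → Prop
  bi_symm : ∀ u v, bi u v → bi v u

/-- The three ways in which a walk may traverse an edge from `u` to `v`:
`u → v`, `u ← v`, `u ↔ v`. -/
inductive Step where
  | fwd
  | bwd
  | bidir

namespace Step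

/-- The edge carries an arrowhead at the vertex that the walk leaves. -/
def headAtSource : Step → Bool
  | fwd => false
  | bwd => true
  | bidir => true

/-- The edge carries an arrowhead at the vertex that the walk enters. -/
def headAtTarget : Step → Bool
  | fwd => true
  | bwd => false
  | bidir => true

end Step

namespace MixedGraph

variable {V : Type*}

/-- An acyclic directed mixed graph: no directed cycle (in particular no directed self-loop), and
bidirected edges join distinct vertices. -/
def IsADMG (G : MixedGraph V) : Prop :=
  (∀ v, ¬ Relation.TransGen G.dir v v) ∧ ∀ v, ¬ G.bi v v

/-- `G.Anc S` is the set of ancestors of `S` in `G`; every vertex is an ancestor of itself. -/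
def Anc (G : MixedGraph V) (S : Set V) : Set V :=
  {u | ∃ v ∈ S, Relation.ReflTransGen G.dir u v}

/-- The mutilated graph in which the edges with an arrowhead into `A` and the (directed) edges with
a tail from `B` are removed. -/
def mutilate (G : MixedGraph V) (A B : Set V) : MixedGraph V where
  dir u v := G.dir u v ∧ v ∉ A ∧ u ∉ B
  bi u v := G.bi u v ∧ u ∉ A ∧ v ∉ A
  bi_symm u v h := ⟨G.bi_symm u v h.1, h.2.2, h.2.1⟩

/-- `G.HasStep k u v`: the graph has an edge that a walk traverses from `u` to `v` in the
way `k`. -/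
def HasStep (G : MixedGraph V) : Step → V → V → Prop
  | Step.fwd, u, v => G.dir u v
  | Step.bwd, u, v => G.dir v u
  | Step.bidir, u, v => G.bi u v

/-- Walks in a mixed graph, as sequences of vertices and edges. The edges are recorded because two
vertices may be joined both by a directed and by a bidirected edge. -/
inductive Walk (G : MixedGraph V) : V → V → Type _ where
  | nil (u : V) : Walk G u u
  | cons {u v w : V} (k : Step) (h : G.HasStep k u v) (p : Walk G v w) : Walk G u w

namespace Walk

variable {G : MixedGraph V}

/-- The sequence of vertices of a walk. -/
def support : {u v : V} → Walk G u v → List V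
  | _, _, nil u => [u]
  | u, _, cons _ _ p => u :: p.support

/-- A path is a walk without repeated vertices. -/
def IsPath {u v : V} (p : Walk G u v) : Prop := p.support.Nodup

/-- Every vertex of the walk is active relative to `Z`, where `inHead` says whether the edge by
which the first vertex was entered (if any) has an arrowhead there. A vertex with arrowheads on both
sides is a collider, and it is active if it or one of its descendants is in `Z`, that is, if it is
an ancestor of `Z`; all other vertices, endpoints included, are non-colliders, and they are active
if they are not in `Z`. -/
def ActiveFrom (Z : Set V) : {u v : V} → (inHead : Bool) → Walk G u v → Prop
  | _, _, _, nil u => u ∉ Z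
  | u, _, inHead, cons k _ p =>
      (if (inHead && k.headAtSource) = true then u ∈ G.Anc Z else u ∉ Z) ∧
        p.ActiveFrom Z k.headAtTarget

/-- Every vertex of the walk is active relative to `Z`. -/
def Active (Z : Set V) {u v : V} (p : Walk G u v) : Prop := p.ActiveFrom Z false

end Walk

/-- `X` and `Y` are d-separated by `Z` in `G`: no path between `X` and `Y` is active given `Z`. -/
def DSep (G : MixedGraph V) (X Y Z : Set V) : Prop :=
  ∀ x ∈ X, ∀ y ∈ Y, ∀ p : G.Walk x y, p.IsPath → ¬ p.Active Z

end MixedGraph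

/-- The three rules of Pearl's do-calculus. -/
inductive PearlRule where
  | R1
  | R2
  | R3

/-- The d-separation condition of a rule of Pearl's calculus, applied to `(W, X, Y, Z)`, in the
associated mutilated graph of `G`. In the third rule, `X \ Anc(Z, G_{\overline W})` is the set
usually written `X(Z)`. -/
def PearlRule.Holds {V : Type*} (i : PearlRule) (G : MixedGraph V) (W X Y Z : Set V) : Prop :=
  match i with
  | PearlRule.R1 => (G.mutilate W ∅).DSep Y X (W ∪ Z)
  | PearlRule.R2 => (G.mutilate W X).DSep Y X (W ∪ Z)
  | PearlRule.R3 => (G.mutilate (W ∪ (X \ (G.mutilate W ∅).Anc Z)) ∅).DSep Y X (W ∪ Z)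

/-- A mixed graph on a set `C` of clusters, possibly with self-loops and cycles, together with the
number of micro-variables of each cluster, which is at least one. -/
structure ClusterGraph (C : Type*) extends MixedGraph C where
  /-- The cardinality of each cluster. -/
  size : C → ℕ
  size_pos : ∀ c, 0 < size c

namespace ClusterGraph

variable {C : Type*}

/-- The micro-variables: the cluster `c` consists of `⟨c, 0⟩, …, ⟨c, size c - 1⟩`. -/
abbrev Micro (G : ClusterGraph C) : Type _ := Σ c : C, Fin (G.size c)

/-- The set of micro-variables that lie in a given set of clusters. -/
def microSet (G : ClusterGraph C) (S : Set C) : Set G.Micro := {v | v.1 ∈ S}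

/-- A graph on the micro-variables is compatible with the cluster graph if it is an ADMG and there
is an edge between two clusters (possibly equal) exactly when there is an edge of the same type
between some of their elements. -/
def Compatible (G : ClusterGraph C) (M : MixedGraph G.Micro) : Prop :=
  M.IsADMG ∧
  (∀ c d, G.dir c d ↔ ∃ (i : Fin (G.size c)) (j : Fin (G.size d)), M.dir ⟨c, i⟩ ⟨d, j⟩) ∧
  (∀ c d, G.bi c d ↔ ∃ (i : Fin (G.size c)) (j : Fin (G.size d)), M.bi ⟨c, i⟩ ⟨d, j⟩)

/-- A C-DAG is a cluster graph that arises from some ADMG on the micro-variables. -/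
def IsCDAG (G : ClusterGraph C) : Prop := ∃ M : MixedGraph G.Micro, G.Compatible M

/-- The cluster graph with the same edges in which every cluster of size greater than 3 is reduced
to size 3. -/
def shrink (G : ClusterGraph C) : ClusterGraph C where
  toMixedGraph := G.toMixedGraph
  size c := min (G.size c) 3
  size_pos c := lt_min (G.size_pos c) (by norm_num)

end ClusterGraph

/-!
A graph on the reduced micro-variables in which the rule fails extends by isolated
micro-variables. Conversely, let the rule fail in `M`. Failure of a rule is the existence of an
active walk in a mutilated graph; walks may be used instead of paths
(`MixedGraph.linked_iff_not_dSep`). In the third rule, the condition on `X` says just that an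
active walk may enter its end vertex in `X` through an arrowhead only if this vertex is an
ancestor of the conditioning set (`PearlRule.linked_mutilate_iff`). So all three mutilations are
determined by clusters, and adding edges preserves failure.

A topological order gives ranks to the micro-variables, and `M` may be replaced by the graph on
the pairs (cluster, rank) with every bidirected edge that the cluster graph allows, and every
directed edge that it allows and that increases the rank (`MixedGraph.rankGraph`). In this graph,
a lower vertex of a cluster has at least the children of a higher one, and at most its parents.
Let `m < a < b` be vertices of one cluster. Then one of `a`, `b` is dispensable
(`MixedGraph.linked_diff_or_linked_diff`):

* If `b` is an ancestor of the conditioning set, then `a` is dispensable: `b` replaces it as a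
  collider, `m` as a fork, and a passage `→ a →` becomes `→ b → d ← m →`, where `d` is a child of
  `b` that is an ancestor of the conditioning set.
* If `b` is not an ancestor of the conditioning set and an active walk passes through `b`, then on
  one side of `b` it is a directed path from `b` to an end, which runs through vertices above `b`
  and can be entered from `a` as well as from `b`. If the other part of the walk enters `b`
  otherwise than by `→`, then it can enter `a` instead, and `b` is dispensable. So it is if this
  part, or a directed path from one of its colliders to the conditioning set, visits `a`, since
  the walk can turn there. Otherwise `a` is dispensable.

Hence, as long as a cluster has four vertices, a vertex other than its lowest and its highest one
can be deleted. The lowest and the highest vertices of the clusters already realize all directed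
edges of the cluster graph, so the graph that remains is compatible with the reduced cluster
graph, once bidirected loops are removed, which no path uses.
-/

/-! ### Active walks as reachability -/

namespace Step

/-- The same edge, traversed in the opposite direction. -/
def reverse : Step → Step
  | fwd => bwd
  | bwd => fwd
  | bidir => bidir

@[simp] lemma headAtSource_reverse (k : Step) : k.reverse.headAtSource = k.headAtTarget := by
  cases k <;> rfl

@[simp] lemma headAtTarget_reverse (k : Step) : k.reverse.headAtTarget = k.headAtSource := by
  cases k <;> rfl

end Step

namespace MixedGraph

variable {V V' : Type*}

lemma HasStep.reverse {H : MixedGraph V} {k : Step} {u v : V} (h : H.HasStep k u v) :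
    H.HasStep k.reverse v u := by
  cases k
  · exact h
  · exact h
  · exact H.bi_symm _ _ h

lemma mem_anc_of_mem {H : MixedGraph V} {K : Set V} {v : V} (hv : v ∈ K) : v ∈ H.Anc K :=
  ⟨v, hv, Relation.ReflTransGen.refl⟩

lemma mem_anc_of_dir {H : MixedGraph V} {K : Set V} {u v : V} (huv : H.dir u v)
    (hv : v ∈ H.Anc K) : u ∈ H.Anc K := by
  obtain ⟨z, hz, hvz⟩ := hv
  exact ⟨z, hz, Relation.ReflTransGen.head huv hvz⟩

lemma anc_mono {H : MixedGraph V} {K K' : Set V} (h : K ⊆ K') : H.Anc K ⊆ H.Anc K' :=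
  fun _ ⟨z, hz, hvz⟩ => ⟨z, h hz, hvz⟩

lemma anc_induction {H : MixedGraph V} {K : Set V} {p : ∀ v, v ∈ H.Anc K → Prop}
    (base : ∀ v (hv : v ∈ K), p v (mem_anc_of_mem hv))
    (step : ∀ u v (huv : H.dir u v) (hv : v ∈ H.Anc K), p v hv → p u (mem_anc_of_dir huv hv))
    {v : V} (hv : v ∈ H.Anc K) : p v hv := by
  obtain ⟨z, hz, hvz⟩ := id hv
  induction hvz using Relation.ReflTransGen.head_induction_on with
  | refl => exact base z hz
  | head huw hwz ih => exact step _ _ huw ⟨z, hz, hwz⟩ (ih ⟨z, hz, hwz⟩)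

lemma exists_dir_of_mem_anc {H : MixedGraph V} {K : Set V} {u : V} (hu : u ∈ H.Anc K)
    (hK : u ∉ K) : ∃ v, H.dir u v ∧ v ∈ H.Anc K := by
  obtain ⟨z, hz, huz⟩ := hu
  rcases huz.cases_head with rfl | ⟨v, huv, hvz⟩
  · exact absurd hz hK
  · exact ⟨v, huv, z, hz, hvz⟩

/-- The vertex `v` does not block a walk that passes it given `K`, where `h` and `h'` say whether
the two edges of the walk at `v` have an arrowhead there. -/
def Passable (H : MixedGraph V) (K : Set V) (h h' : Bool) (v : V) : Prop :=
  if (h && h') = true then v ∈ H.Anc K else v ∉ K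

section Passable

variable {H : MixedGraph V} {K : Set V} {h h' : Bool} {v : V}

@[simp] lemma passable_true_true : H.Passable K true true v ↔ v ∈ H.Anc K := by simp [Passable]

@[simp] lemma passable_false_left : H.Passable K false h v ↔ v ∉ K := by simp [Passable]

@[simp] lemma passable_false_right : H.Passable K h false v ↔ v ∉ K := by simp [Passable]

lemma passable_comm : H.Passable K h h' v ↔ H.Passable K h' h v := by
  simp [Passable, Bool.and_comm]

lemma Passable.of_not_mem_anc (hp : H.Passable K h true v) (hv : v ∉ H.Anc K) : h = false := by
  cases h
  · rfl
  · exact absurd (passable_true_true.1 hp) hv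

lemma Passable.imp {H' : MixedGraph V'} {K' : Set V'} {v' : V'} (hp : H.Passable K h h' v)
    (hanc : v ∈ H.Anc K → v' ∈ H'.Anc K') (hK : v ∉ K → v' ∉ K') : H'.Passable K' h h' v' := by
  unfold Passable at *
  split_ifs at * with hc
  · exact hanc hp
  · exact hK hp

end Passable

/-- `H.Reach K Y f h v`: some walk from `Y` arrives at `v`, all its vertices before `v` being active
given `K`, and `h` says whether its last edge has an arrowhead at `v`. The first vertex is treated
as if the walk had entered it by an edge with arrowhead status `f`; so `f = false` makes it a
non-collider, and for `f = true` it has to be an ancestor of `K` if the walk leaves it through an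
arrowhead. The walk of length zero has `h = f`. -/
inductive Reach (H : MixedGraph V) (K Y : Set V) (f : Bool) : Bool → V → Prop
  | start {v : V} (hv : v ∈ Y) : Reach H K Y f f v
  | step {h : Bool} {u v : V} (k : Step) (hu : Reach H K Y f h u)
      (hp : H.Passable K h k.headAtSource u) (hk : H.HasStep k u v) :
      Reach H K Y f k.headAtTarget v

/-- An active walk given `K` joins `Y` to `X`, the end vertices being treated as if the walk
continued beyond them by edges with arrowhead status `f` and `g` there. -/
def Linked (H : MixedGraph V) (K Y : Set V) (f : Bool) (X : Set V) (g : Bool) : Prop :=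
  ∃ h, ∃ x ∈ X, H.Reach K Y f h x ∧ H.Passable K h g x

section Reach

variable {H : MixedGraph V} {K X Y : Set V} {f g h h' : Bool} {u v : V}

lemma Reach.fwd (hu : H.Reach K Y f h u) (hK : u ∉ K) (huv : H.dir u v) :
    H.Reach K Y f true v :=
  hu.step Step.fwd (passable_false_right.2 hK) huv

lemma Reach.bwd (hu : H.Reach K Y f h u) (hp : H.Passable K h true u) (hvu : H.dir v u) :
    H.Reach K Y f false v :=
  hu.step Step.bwd hp hvu

lemma Reach.bidir (hu : H.Reach K Y f h u) (hp : H.Passable K h true u) (huv : H.bi u v) :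
    H.Reach K Y f true v :=
  hu.step Step.bidir hp huv

/-- Two active partial walks that meet in a vertex which they do not block combine. -/
lemma linked_of_reach (hX : H.Reach K X g h' v) : ∀ {h}, H.Reach K Y f h v →
    H.Passable K h h' v → H.Linked K Y f X g := by
  induction hX with
  | start hv => exact fun hY hp => ⟨_, _, hv, hY, hp⟩
  | step k _ hp hk ih =>
    intro h hY hp'
    refine ih (h := k.headAtSource) ?_ (passable_comm.1 hp)
    simpa using hY.step k.reverse (by simpa using hp') hk.reverse

lemma Linked.symm (hl : H.Linked K Y f X g) : H.Linked K X g Y f := by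
  obtain ⟨h, x, hx, hr, hp⟩ := hl
  exact linked_of_reach hr (Reach.start hx) (passable_comm.1 hp)

lemma anc_map (hv : v ∈ H.Anc K) {H' : MixedGraph V'} {K' : Set V'} (φ : V → V')
    (hdir : ∀ u v, H.dir u v → H'.dir (φ u) (φ v)) (hK : ∀ v ∈ K, φ v ∈ K') :
    φ v ∈ H'.Anc K' := by
  obtain ⟨z, hz, hvz⟩ := hv
  exact ⟨φ z, hK z hz, hvz.lift φ hdir⟩

lemma Reach.map (hr : H.Reach K Y f h v) {H' : MixedGraph V'} {K' Y' : Set V'} (φ : V → V')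
    (hdir : ∀ u v, H.dir u v → H'.dir (φ u) (φ v)) (hbi : ∀ u v, H.bi u v → H'.bi (φ u) (φ v))
    (hK : ∀ v, v ∈ K ↔ φ v ∈ K') (hY : ∀ v ∈ Y, φ v ∈ Y') :
    H'.Reach K' Y' f h (φ v) := by
  induction hr with
  | start hv => exact Reach.start (hY _ hv)
  | @step h u v k _ hp hk ih =>
    refine ih.step k (hp.imp (fun h => anc_map h φ hdir fun v => (hK v).1) (mt (hK u).2)) ?_
    cases k
    · exact hdir _ _ hk
    · exact hdir _ _ hk
    · exact hbi _ _ hk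

lemma Linked.map (hl : H.Linked K Y f X g) {H' : MixedGraph V'} {K' X' Y' : Set V'} (φ : V → V')
    (hdir : ∀ u v, H.dir u v → H'.dir (φ u) (φ v)) (hbi : ∀ u v, H.bi u v → H'.bi (φ u) (φ v))
    (hK : ∀ v, v ∈ K ↔ φ v ∈ K') (hY : ∀ v ∈ Y, φ v ∈ Y') (hX : ∀ v ∈ X, φ v ∈ X') :
    H'.Linked K' Y' f X' g := by
  obtain ⟨h, x, hx, hr, hp⟩ := hl
  exact ⟨h, φ x, hX x hx, hr.map φ hdir hbi hK hY,
    hp.imp (fun h => anc_map h φ hdir fun v => (hK v).1) (mt (hK x).2)⟩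

end Reach

/-! ### From active walks to active paths -/

namespace Walk

variable {H : MixedGraph V} {K : Set V}

/-- The part of an active walk from an occurrence of `u` on is active if `u` is entered as in the
walk. If the walk starts with an arrowhead at `v` but enters `u` through a tail, then following the
arrows from `v` leads to a collider. -/
lemma exists_suffix {u v w : V} (p : H.Walk v w) : ∀ {h : Bool}, p.ActiveFrom K h →
    u ∈ p.support → ∃ (h' : Bool) (q : H.Walk u w), q.ActiveFrom K h' ∧
      q.support.Sublist p.support ∧ (h = true → h' = false → v ∈ H.Anc K) := by
  induction p with
  | nil v =>
    intro h hp hu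
    obtain rfl : u = v := by simpa [support] using hu
    exact ⟨h, nil u, hp, List.Sublist.refl _, by simp_all⟩
  | @cons v v' w k hk p ih =>
    intro h hp hu
    by_cases huv : u = v
    · subst huv
      exact ⟨h, cons k hk p, hp, List.Sublist.refl _, by simp_all⟩
    · obtain ⟨h', q, hq, hs, hanc⟩ := ih hp.2 (by simpa [support, huv] using hu)
      refine ⟨h', q, hq, hs.cons _, ?_⟩
      rintro rfl hh'
      have h1 := hp.1
      cases k
      · exact mem_anc_of_dir hk (hanc rfl hh')
      · simpa [Step.headAtSource] using h1
      · simpa [Step.headAtSource] using h1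

lemma exists_isPath {u w : V} (p : H.Walk u w) : ∀ {h : Bool}, p.ActiveFrom K h →
    ∃ q : H.Walk u w, q.IsPath ∧ q.ActiveFrom K h := by
  induction p with
  | nil u => exact fun hp => ⟨nil u, by simp [IsPath, support], hp⟩
  | @cons u v w k hk p ih =>
    intro h hp
    obtain ⟨q, hq, hqa⟩ := ih hp.2
    by_cases hu : u ∈ q.support
    · obtain ⟨h', r, hr, hs, hanc⟩ := q.exists_suffix hqa hu
      refine ⟨r, hs.nodup hq, ?_⟩
      have h1 := hp.1
      cases r with
      | nil => exact hr
      | cons k' hk' r =>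
        refine ⟨?_, hr.2⟩
        have h2 := hr.1
        -- The only new collider at `u` to worry about has `u → v` as discarded edge.
        cases h <;> cases h' <;> cases hks : k'.headAtSource <;> cases k <;>
          simp_all [Step.headAtSource, Step.headAtTarget]
        exact mem_anc_of_dir hk hanc
    · exact ⟨cons k hk q, List.nodup_cons.2 ⟨hu, hq⟩, hp.1, hqa⟩

lemma reach_of_activeFrom {Y : Set V} {f : Bool} {u w : V} (p : H.Walk u w) : ∀ {h : Bool},
    p.ActiveFrom K h → H.Reach K Y f h u → ∃ h', H.Reach K Y f h' w ∧ w ∉ K := by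
  induction p with
  | nil u => exact fun hp hr => ⟨_, hr, hp⟩
  | cons k hk p ih => exact fun hp hr => ih hp.2 (hr.step k hp.1 hk)

lemma exists_of_reach {X : Set V} {v : V} {h' : Bool} (hr : H.Reach K X false h' v) :
    ∀ {h}, H.Passable K h h' v → ∃ x ∈ X, ∃ p : H.Walk v x, p.ActiveFrom K h := by
  induction hr with
  | start hv => exact fun hp => ⟨_, hv, nil _, passable_false_right.1 hp⟩
  | @step h₁ u v k _ hp hk ih =>
    intro h hp'
    obtain ⟨x, hx, p, hpa⟩ := ih (passable_comm.1 hp)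
    exact ⟨x, hx, cons k.reverse hk.reverse p, by simpa [Passable] using hp', by simpa using hpa⟩

end Walk

/-- The graph without its bidirected loops. -/
def loopless (H : MixedGraph V) : MixedGraph V where
  dir := H.dir
  bi u v := H.bi u v ∧ u ≠ v
  bi_symm u v h := ⟨H.bi_symm u v h.1, h.2.symm⟩

namespace Walk

variable {H : MixedGraph V} {K : Set V}

/-- A path uses no loops. -/
lemma exists_loopless_walk {A B : Set V} {u w : V} (p : (H.mutilate A B).Walk u w) :
    ∀ {h : Bool}, p.IsPath → p.ActiveFrom K h →
      ∃ q : (H.loopless.mutilate A B).Walk u w, q.support = p.support ∧ q.ActiveFrom K h := by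
  induction p with
  | nil u => exact fun _ hp => ⟨nil u, rfl, hp⟩
  | @cons u v w k hk p ih =>
    intro h hpath hp
    have hn := List.nodup_cons.1 hpath
    obtain ⟨q, hq, hqa⟩ := ih hn.2 hp.2
    have huv : u ≠ v := by
      rintro rfl
      apply hn.1
      cases p <;> simp [support]
    have hk' : (H.loopless.mutilate A B).HasStep k u v := by
      cases k
      · exact hk
      · exact hk
      · exact ⟨⟨hk.1, huv⟩, hk.2⟩
    exact ⟨cons k hk' q, by simp [support, hq], hp.1, hqa⟩

end Walk

lemma linked_iff_not_dSep {H : MixedGraph V} {K X Y : Set V} :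
    H.Linked K Y false X false ↔ ¬ H.DSep Y X K := by
  constructor
  · intro hl hd
    obtain ⟨h, y, hy, hr, hp⟩ := hl.symm
    obtain ⟨x, hx, p, hpa⟩ := Walk.exists_of_reach hr (passable_comm.1 hp)
    obtain ⟨q, hq, hqa⟩ := p.exists_isPath hpa
    exact hd y hy x hx q hq hqa
  · intro hd
    simp only [DSep, not_forall, not_not] at hd
    obtain ⟨y, hy, x, hx, p, -, hpa⟩ := hd
    obtain ⟨h, hr, hxK⟩ := p.reach_of_activeFrom hpa (Reach.start hy)
    exact ⟨h, x, hx, hr, passable_false_right.2 hxK⟩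

lemma dSep_of_loopless {H : MixedGraph V} {A B K X Y : Set V}
    (hd : (H.loopless.mutilate A B).DSep Y X K) : (H.mutilate A B).DSep Y X K := by
  intro y hy x hx p hp hpa
  obtain ⟨q, hq, hqa⟩ := p.exists_loopless_walk hp hpa
  exact hd y hy x hx q (by rw [Walk.IsPath, hq]; exact hp) hqa

end MixedGraph

/-! ### The rules of the do-calculus in terms of active walks -/

namespace MixedGraph

variable {V : Type*} {H : MixedGraph V} {K X Y : Set V} {f g h h' : Bool} {v : V}

/-- A walk that leaves a non-ancestor of the conditioning set through a tail meets no collider, so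
it is a directed path to its other end. -/
lemma Reach.exists_directed (hr : H.Reach K X f h v) : H.Passable K h true v → v ∉ H.Anc K →
    f = false ∧ ∃ x ∈ X, Relation.ReflTransGen (fun u w => H.dir u w ∧ w ∉ K) v x := by
  induction hr with
  | start hv => exact fun hp hK => ⟨hp.of_not_mem_anc hK, _, hv, Relation.ReflTransGen.refl⟩
  | @step h u v k _ hp hk ih =>
    intro hp' hK
    cases k
    · simp [Step.headAtTarget, hK] at hp'
    · have hu : u ∉ H.Anc K := fun hu => hK (mem_anc_of_dir hk hu)
      obtain ⟨hf, x, hx, hux⟩ := ih hp hu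
      exact ⟨hf, x, hx, hux.head ⟨hk, fun h => hu (mem_anc_of_mem h)⟩⟩
    · simp [Step.headAtTarget, hK] at hp'

/-- An active walk through a vertex splits there into two partial walks; this moves the splitting
vertex one edge back. -/
lemma Reach.step_back {u : V} {k : Step} (hr : H.Reach K X g h' v)
    (hp : H.Passable K k.headAtTarget h' v) (hk : H.HasStep k u v) :
    H.Reach K X g k.headAtSource u := by
  simpa using hr.step k.reverse (by simpa using passable_comm.1 hp) hk.reverse

end MixedGraph

namespace PearlRule

open MixedGraph

variable {V V' : Type*}

/-- The set from which the edges with a tail are removed in a rule. -/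
def tails (i : PearlRule) (X : Set V) : Set V :=
  match i with
  | R2 => X
  | _ => ∅

/-- The arrowhead status with which `X` is treated in a rule. In the third rule the edges with an
arrowhead at a vertex of `X` survive only if this vertex is an ancestor of the conditioning set,
that is, if it would be active as a collider. -/
def flag (i : PearlRule) : Bool :=
  match i with
  | R3 => true
  | _ => false

section R3

variable {M : MixedGraph V} {W X Y Z : Set V}

lemma mem_anc_of_mem_anc_union {u : V} (hu : u ∈ (M.mutilate W ∅).Anc (W ∪ Z)) :
    u ∉ W → u ∈ (M.mutilate W ∅).Anc Z := by
  induction hu using anc_induction with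
  | base v hv => exact fun hW => mem_anc_of_mem (hv.resolve_left hW)
  | step u v huv _ ih => exact fun _ => mem_anc_of_dir huv (ih huv.2.1)

lemma mem_anc_mutilate_of_mem_anc {u : V} (hu : u ∈ (M.mutilate W ∅).Anc Z) :
    u ∈ (M.mutilate (W ∪ (X \ (M.mutilate W ∅).Anc Z)) ∅).Anc Z := by
  induction hu using anc_induction with
  | base v hv => exact mem_anc_of_mem hv
  | step u v huv hv ih =>
    exact mem_anc_of_dir ⟨huv.1, by simpa [hv] using huv.2.1, huv.2.2⟩ ih

lemma linked_or_reach_mutilate (hWX : Disjoint W X) (hXZ : Disjoint X Z) {h : Bool} {w : V}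
    (hr : (M.mutilate W ∅).Reach (W ∪ Z) Y false h w) :
    ∀ {h'}, (M.mutilate W ∅).Reach (W ∪ Z) X true h' w →
      (M.mutilate W ∅).Passable (W ∪ Z) h h' w →
      (M.mutilate (W ∪ (X \ (M.mutilate W ∅).Anc Z)) ∅).Linked (W ∪ Z) Y false X false ∨
      (M.mutilate (W ∪ (X \ (M.mutilate W ∅).Anc Z)) ∅).Reach (W ∪ Z) Y false h w := by
  have hK : ∀ x ∈ X, x ∉ W ∪ Z := fun x hx h =>
    h.elim (fun h => hWX.le_bot ⟨h, hx⟩) (fun h => hXZ.le_bot ⟨hx, h⟩)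
  -- A vertex entered through an arrowhead from which the walk continues to `X` is not cut off.
  have hgood : ∀ {w h'}, (M.mutilate W ∅).Reach (W ∪ Z) X true h' w →
      (M.mutilate W ∅).Passable (W ∪ Z) true h' w → w ∉ W →
      w ∉ W ∪ (X \ (M.mutilate W ∅).Anc Z) := by
    rintro w h' hr hp hW (h | ⟨-, h⟩)
    · exact hW h
    · have := (hr.exists_directed (passable_comm.1 hp) fun h' =>
        h (mem_anc_of_mem_anc_union h' hW)).1
      simp at this
  induction hr with
  | start hv => exact fun _ _ => Or.inr (Reach.start hv)
  | @step h p w k _ hp hk ih =>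
    intro h' hw hpw
    have hpX := hw.step_back hpw hk
    rcases ih hpX hp with hl | hr
    · exact Or.inl hl
    -- If an arrowhead at `p` is cut off, then `p` lies in `X`, and the walk may end there.
    have hpgood : k.headAtSource = true → p ∉ W →
        (M.mutilate (W ∪ (X \ (M.mutilate W ∅).Anc Z)) ∅).Linked (W ∪ Z) Y false X false ∨
        p ∉ W ∪ (X \ (M.mutilate W ∅).Anc Z) := by
      intro _ hW
      by_cases hb : p ∈ X
      · exact Or.inl ⟨h, p, hb, hr, passable_false_right.2 (hK p hb)⟩
      · exact Or.inr (by simp [hW, hb])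
    have hpass : p ∉ W → (M.mutilate (W ∪ (X \ (M.mutilate W ∅).Anc Z)) ∅).Passable (W ∪ Z)
        h k.headAtSource p := fun hW => hp.imp (fun ha => anc_mono Set.subset_union_right
          (mem_anc_mutilate_of_mem_anc (mem_anc_of_mem_anc_union ha hW))) id
    cases k
    · exact Or.inr (hr.fwd (passable_false_right.1 hp)
        ⟨hk.1, hgood hw hpw hk.2.1, hk.2.2⟩)
    · refine (hpgood rfl hk.2.1).imp id fun hg => ?_
      exact hr.bwd (hpass hk.2.1) ⟨hk.1, hg, hk.2.2⟩
    · refine (hpgood rfl hk.2.1).imp id fun hg => ?_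
      exact hr.bidir (hpass hk.2.1) ⟨hk.1, hg, hgood hw hpw hk.2.2⟩

lemma linked_mutilate_iff (hWX : Disjoint W X) (hXZ : Disjoint X Z) :
    (M.mutilate (W ∪ (X \ (M.mutilate W ∅).Anc Z)) ∅).Linked (W ∪ Z) Y false X false ↔
      (M.mutilate W ∅).Linked (W ∪ Z) Y false X true := by
  constructor
  · rintro ⟨h, x, hx, hr, hp⟩
    have hxK := passable_false_right.1 hp
    refine ⟨h, x, hx, hr.map id (fun u v huv => ⟨huv.1, fun h => huv.2.1 (Or.inl h), huv.2.2⟩)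
      (fun u v huv => ⟨huv.1, fun h => huv.2.1 (Or.inl h), fun h => huv.2.2 (Or.inl h)⟩)
      (fun _ => Iff.rfl) (fun _ h => h), ?_⟩
    have hanc : ∀ {x}, x ∈ X → x ∉ W ∪ (X \ (M.mutilate W ∅).Anc Z) →
        x ∈ (M.mutilate W ∅).Anc (W ∪ Z) := by
      intro x hx h
      by_contra hn
      exact h (Or.inr ⟨hx, fun h => hn (anc_mono Set.subset_union_right h)⟩)
    cases hr with
    | start => exact passable_false_left.2 hxK
    | step k _ _ hk =>
      cases k
      · exact passable_true_true.2 (hanc hx hk.2.1)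
      · exact passable_false_left.2 hxK
      · exact passable_true_true.2 (hanc hx hk.2.2)
  · rintro ⟨h, x, hx, hr, hp⟩
    rcases linked_or_reach_mutilate hWX hXZ hr (Reach.start hx) hp with hl | hr'
    · exact hl
    · exact ⟨h, x, hx, hr', passable_false_right.2 fun h =>
        h.elim (fun h => hWX.le_bot ⟨h, hx⟩) (fun h => hXZ.le_bot ⟨hx, h⟩)⟩

end R3

lemma not_holds_iff (i : PearlRule) {M : MixedGraph V} {W X Y Z : Set V} (hWX : Disjoint W X)
    (hXZ : Disjoint X Z) :
    ¬ i.Holds M W X Y Z ↔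
      (M.mutilate W (i.tails X)).Linked (W ∪ Z) Y false X i.flag := by
  cases i
  · exact linked_iff_not_dSep.symm
  · exact linked_iff_not_dSep.symm
  · exact linked_iff_not_dSep.symm.trans (linked_mutilate_iff hWX hXZ)

/-- Failure of a rule is preserved by maps that preserve edges and reflect the four sets. -/
lemma not_holds_map (i : PearlRule) {M : MixedGraph V} {M' : MixedGraph V'} (φ : V → V')
    (hdir : ∀ u v, M.dir u v → M'.dir (φ u) (φ v)) (hbi : ∀ u v, M.bi u v → M'.bi (φ u) (φ v))
    {W X Y Z : Set V'} (hWX : Disjoint W X) (hXZ : Disjoint X Z)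
    (hn : ¬ i.Holds M (φ ⁻¹' W) (φ ⁻¹' X) (φ ⁻¹' Y) (φ ⁻¹' Z)) : ¬ i.Holds M' W X Y Z := by
  rw [not_holds_iff i (hWX.preimage φ) (hXZ.preimage φ)] at hn
  rw [not_holds_iff i hWX hXZ]
  refine hn.map φ (fun u v huv => ⟨hdir u v huv.1, huv.2.1, ?_⟩)
    (fun u v huv => ⟨hbi u v huv.1, huv.2⟩) (fun _ => Iff.rfl) (fun _ h => h) (fun _ h => h)
  cases i
  · exact huv.2.2
  · exact huv.2.2
  · exact huv.2.2

lemma holds_of_loopless (i : PearlRule) {M : MixedGraph V} {W X Y Z : Set V}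
    (h : i.Holds M.loopless W X Y Z) : i.Holds M W X Y Z := by
  cases i
  · exact dSep_of_loopless h
  · exact dSep_of_loopless h
  · exact dSep_of_loopless h

end PearlRule

/-! ### Graphs of clusters and ranks -/

namespace MixedGraph

variable {C : Type*}

/-- The graph on a set `S` of pairs (cluster, rank) with all directed edges that the graph `G` on
the clusters allows and that increase the rank, and with all bidirected edges, loops included, that
`G` allows. The pairs outside `S` are isolated vertices. -/
def rankGraph (G : MixedGraph C) (S : Set (C × ℕ)) : MixedGraph (C × ℕ) where
  dir u v := G.dir u.1 v.1 ∧ u.2 < v.2 ∧ u ∈ S ∧ v ∈ S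
  bi u v := G.bi u.1 v.1 ∧ u ∈ S ∧ v ∈ S
  bi_symm _ _ h := ⟨G.bi_symm _ _ h.1, h.2.2, h.2.1⟩

variable {G : MixedGraph C} {S S' : Set (C × ℕ)} {K X Y : Set C} {f g h h' : Bool}
  {m a b u v w : C × ℕ}

lemma rankGraph_dir_of_le {u' v' : C × ℕ} (huv : (G.rankGraph S).dir u v) (hu : u'.1 = u.1)
    (hv : v'.1 = v.1) (hul : u'.2 ≤ u.2) (hvl : v.2 ≤ v'.2) (hu' : u' ∈ S') (hv' : v' ∈ S') :
    (G.rankGraph S').dir u' v' :=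
  ⟨hu ▸ hv ▸ huv.1, (hul.trans_lt huv.2.1).trans_le hvl, hu', hv'⟩

lemma rankGraph_bi_of_eq {u' v' : C × ℕ} (huv : (G.rankGraph S).bi u v) (hu : u'.1 = u.1)
    (hv : v'.1 = v.1) (hu' : u' ∈ S') (hv' : v' ∈ S') : (G.rankGraph S').bi u' v' :=
  ⟨hu ▸ hv ▸ huv.1, hu', hv'⟩

lemma Reach.rankGraph_mono (hS : S ⊆ S')
    (hr : (G.rankGraph S).Reach (Prod.fst ⁻¹' K) (Prod.fst ⁻¹' Y) f h v) :
    (G.rankGraph S').Reach (Prod.fst ⁻¹' K) (Prod.fst ⁻¹' Y) f h v :=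
  hr.map id (fun _ _ h => ⟨h.1, h.2.1, hS h.2.2.1, hS h.2.2.2⟩)
    (fun _ _ h => ⟨h.1, hS h.2.1, hS h.2.2⟩) (fun _ => Iff.rfl) (fun _ h => h)

/-! ### Deleting an ancestor of the conditioning set -/

lemma mem_anc_diff_of_lt (hv : v ∈ (G.rankGraph S).Anc (Prod.fst ⁻¹' K)) :
    a.2 < v.2 → v ∈ (G.rankGraph (S \ {a})).Anc (Prod.fst ⁻¹' K) := by
  have hne : ∀ {v : C × ℕ}, a.2 < v.2 → v ≠ a := by rintro v hv rfl; exact lt_irrefl _ hv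
  induction hv using anc_induction with
  | base v hv => exact fun _ => mem_anc_of_mem hv
  | step u v huv _ ih =>
    intro hu
    have hv := hu.trans huv.2.1
    exact mem_anc_of_dir ⟨huv.1, huv.2.1, ⟨huv.2.2.1, hne hu⟩, huv.2.2.2, hne hv⟩ (ih hv)

/-- A vertex that has below and above it vertices of its own cluster, the upper one `b` an ancestor
of the conditioning set, is dispensable: `b` replaces it as a collider, the lower vertex `m`
replaces it where the walk leaves and enters it through tails, and a passage `→ a →` becomes
`→ b → d ← m →` with an ancestor `d` of the conditioning set. -/
lemma linked_diff_of_mem_anc (hm : m ∈ S) (hb : b ∈ S) (hma : m.1 = a.1) (hba : b.1 = a.1)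
    (hlma : m.2 < a.2) (hlab : a.2 < b.2) (hbK : b ∈ (G.rankGraph S).Anc (Prod.fst ⁻¹' K))
    (hl : (G.rankGraph S).Linked (Prod.fst ⁻¹' K) (Prod.fst ⁻¹' Y) f (Prod.fst ⁻¹' X) g) :
    (G.rankGraph (S \ {a})).Linked (Prod.fst ⁻¹' K) (Prod.fst ⁻¹' Y) f (Prod.fst ⁻¹' X) g := by
  have hmS : m ∈ S \ {a} := ⟨hm, by rintro rfl; exact lt_irrefl _ hlma⟩
  have hbS : b ∈ S \ {a} := ⟨hb, by rintro rfl; exact lt_irrefl _ hlab⟩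
  have hbK' : b ∈ (G.rankGraph (S \ {a})).Anc (Prod.fst ⁻¹' K) := mem_anc_diff_of_lt hbK hlab
  have hanc : ∀ {v}, v ∈ (G.rankGraph S).Anc (Prod.fst ⁻¹' K) → v ≠ a →
      v ∈ (G.rankGraph (S \ {a})).Anc (Prod.fst ⁻¹' K) := by
    intro v hv
    induction hv using anc_induction with
    | base v hv => exact fun _ => mem_anc_of_mem hv
    | step u v huv _ ih =>
      intro hu
      by_cases hv : v = a
      · subst hv
        exact mem_anc_of_dir
          (rankGraph_dir_of_le huv rfl hba le_rfl hlab.le ⟨huv.2.2.1, hu⟩ hbS) hbK'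
      · exact mem_anc_of_dir
          (rankGraph_dir_of_le huv rfl rfl le_rfl le_rfl ⟨huv.2.2.1, hu⟩ ⟨huv.2.2.2, hv⟩) (ih hv)
  -- `a` is replaced by `b` if it is entered through an arrowhead, and by `m` otherwise.
  have key : ∀ {h v}, (G.rankGraph S).Reach (Prod.fst ⁻¹' K) (Prod.fst ⁻¹' Y) f h v →
      (v ≠ a → (G.rankGraph (S \ {a})).Reach (Prod.fst ⁻¹' K) (Prod.fst ⁻¹' Y) f h v) ∧
      (v = a → (G.rankGraph (S \ {a})).Reach (Prod.fst ⁻¹' K) (Prod.fst ⁻¹' Y) f h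
        (if h = true then b else m)) := by
    intro h v hr
    induction hr with
    | @start v hv =>
      refine ⟨fun _ => Reach.start hv, ?_⟩
      rintro rfl
      refine Reach.start ?_
      cases f
      · simpa [hma] using hv
      · simpa [hba] using hv
    | @step h u v k _ hp hk ih =>
      -- Departure through a tail is possible from some vertex of at most the same rank.
      have htail : u ∈ S → u ∉ Prod.fst ⁻¹' K → ∃ h' u', u' ∈ S \ {a} ∧ u'.1 = u.1 ∧ u'.2 ≤ u.2 ∧
          (G.rankGraph (S \ {a})).Reach (Prod.fst ⁻¹' K) (Prod.fst ⁻¹' Y) f h' u' := by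
        intro huS huK
        by_cases hu : u = a
        · have hr := ih.2 hu
          subst hu
          cases h
          · exact ⟨_, m, hmS, hma, hlma.le, hr⟩
          · have hbK'' : b ∉ Prod.fst ⁻¹' K := by simpa [hba] using huK
            obtain ⟨d, hbd, hd⟩ := exists_dir_of_mem_anc hbK' hbK''
            exact ⟨_, m, hmS, hma, hlma.le, (Reach.fwd hr hbK'' hbd).bwd
              (passable_true_true.2 hd) (rankGraph_dir_of_le hbd (hma.trans hba.symm) rfl
                (hlma.trans hlab).le le_rfl hmS hbd.2.2.2)⟩
        · exact ⟨_, u, ⟨huS, hu⟩, rfl, le_rfl, ih.1 hu⟩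
      -- Departure through an arrowhead is possible from some vertex of at least the same rank.
      have hhead : u ∈ S → (G.rankGraph S).Passable (Prod.fst ⁻¹' K) h true u →
          ∃ h' u', u' ∈ S \ {a} ∧ u'.1 = u.1 ∧ u.2 ≤ u'.2 ∧
          (G.rankGraph (S \ {a})).Passable (Prod.fst ⁻¹' K) h' true u' ∧
          (G.rankGraph (S \ {a})).Reach (Prod.fst ⁻¹' K) (Prod.fst ⁻¹' Y) f h' u' := by
        intro huS hp
        by_cases hu : u = a
        · have hr := ih.2 hu
          subst hu
          cases h
          · have huK : u ∉ Prod.fst ⁻¹' K := passable_false_left.1 hp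
            have hbK'' : b ∉ Prod.fst ⁻¹' K := by simpa [hba] using huK
            have hmK : m ∉ Prod.fst ⁻¹' K := by simpa [hma] using huK
            obtain ⟨d, hbd, hd⟩ := exists_dir_of_mem_anc hbK' hbK''
            have hmd := rankGraph_dir_of_le hbd (hma.trans hba.symm) rfl
                (hlma.trans hlab).le le_rfl hmS hbd.2.2.2
            exact ⟨_, b, hbS, hba, hlab.le, passable_false_left.2 hbK'',
              (Reach.fwd hr hmK hmd).bwd (passable_true_true.2 hd) hbd⟩
          · exact ⟨_, b, hbS, hba, hlab.le, passable_true_true.2 hbK', hr⟩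
        · exact ⟨_, u, ⟨huS, hu⟩, rfl, le_rfl, hp.imp (fun h => hanc h hu) id, ih.1 hu⟩
      cases k
      · obtain ⟨h', u', hu', hu1, hu2, hr⟩ := htail hk.2.2.1 (passable_false_right.1 hp)
        have huK : u' ∉ Prod.fst ⁻¹' K := by simpa [hu1] using passable_false_right.1 hp
        refine ⟨fun hv => ?_, ?_⟩
        · exact hr.fwd huK (rankGraph_dir_of_le hk hu1 rfl hu2 le_rfl hu' ⟨hk.2.2.2, hv⟩)
        · rintro rfl
          exact hr.fwd huK (rankGraph_dir_of_le hk hu1 hba hu2 hlab.le hu' hbS)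
      · obtain ⟨h', u', hu', hu1, hu2, hp', hr⟩ := hhead hk.2.2.2 hp
        refine ⟨fun hv => ?_, ?_⟩
        · exact hr.bwd hp' (rankGraph_dir_of_le hk rfl hu1 le_rfl hu2 ⟨hk.2.2.1, hv⟩ hu')
        · rintro rfl
          exact hr.bwd hp' (rankGraph_dir_of_le hk hma hu1 hlma.le hu2 hmS hu')
      · obtain ⟨h', u', hu', hu1, hu2, hp', hr⟩ := hhead hk.2.1 hp
        refine ⟨fun hv => ?_, ?_⟩
        · exact hr.bidir hp' (rankGraph_bi_of_eq hk hu1 rfl hu' ⟨hk.2.2, hv⟩)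
        · rintro rfl
          exact hr.bidir hp' (rankGraph_bi_of_eq hk hu1 hba hu' hbS)
  obtain ⟨h, x, hx, hr, hp⟩ := hl
  by_cases hxa : x = a
  · have hr' := (key hr).2 hxa
    subst hxa
    cases h
    · exact ⟨_, m, by simpa [hma] using hx, hr', by simpa [hma] using hp⟩
    · refine ⟨_, b, by simpa [hba] using hx, hr', ?_⟩
      exact hp.imp (fun _ => hbK') (by simp [hba])
  · exact ⟨_, x, hx, (key hr).1 hxa, hp.imp (fun h => hanc h hxa) id⟩

/-! ### Deleting a vertex in the presence of a higher non-ancestor -/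

lemma mem_anc_diff_of_not_mem_anc (hb : b ∉ (G.rankGraph S).Anc (Prod.fst ⁻¹' K))
    (hv : v ∈ (G.rankGraph S).Anc (Prod.fst ⁻¹' K)) :
    v ∈ (G.rankGraph (S \ {b})).Anc (Prod.fst ⁻¹' K) := by
  induction hv using anc_induction with
  | base v hv => exact mem_anc_of_mem hv
  | step u v huv hv ih =>
    refine mem_anc_of_dir ⟨huv.1, huv.2.1, ⟨huv.2.2.1, ?_⟩, huv.2.2.2, ?_⟩ ih
    · rintro rfl
      exact hb (mem_anc_of_dir huv hv)
    · rintro rfl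
      exact hb hv

/-- A walk that leaves a non-ancestor `b` through a tail is directed, so it can start just as well
at a lower vertex of the same cluster, and it uses only vertices above `b`. -/
lemma Reach.start_lower
    (hr : (G.rankGraph S).Reach (Prod.fst ⁻¹' K) (Prod.fst ⁻¹' X) g false b)
    (hb : b ∉ (G.rankGraph S).Anc (Prod.fst ⁻¹' K)) :
    g = false ∧ ∀ S' : Set (C × ℕ), (∀ w ∈ S, b.2 < w.2 → w ∈ S') →
      ∀ a ∈ S', a.1 = b.1 → a.2 ≤ b.2 →
        (G.rankGraph S').Reach (Prod.fst ⁻¹' K) (Prod.fst ⁻¹' X) g false a := by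
  obtain ⟨rfl, x, hx, hbx⟩ := hr.exists_directed
    (passable_false_left.2 fun h => hb (mem_anc_of_mem h)) hb
  refine ⟨rfl, fun S' => ?_⟩
  clear hr hb
  induction hbx using Relation.ReflTransGen.head_induction_on with
  | refl =>
    intro _ a _ hab _
    exact Reach.start (by simpa [hab] using hx)
  | head huw _ ih =>
    intro hS' a ha hab hle
    have hw := hS' _ huw.1.2.2.2 huw.1.2.1
    exact (ih (fun v hv hlt => hS' v hv (huw.1.2.1.trans hlt)) _ hw rfl le_rfl).bwd
      (passable_false_left.2 huw.2) (rankGraph_dir_of_le huw.1 hab rfl hle le_rfl ha hw)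

/-- Either a partial walk, together with directed paths from its colliders to the conditioning set,
avoids `a`, or `a` can be reached, possibly along such a directed path. -/
lemma Reach.exists_or_diff (a : C × ℕ)
    (hr : (G.rankGraph S).Reach (Prod.fst ⁻¹' K) (Prod.fst ⁻¹' Y) f h v) :
    (∃ h', (G.rankGraph S).Reach (Prod.fst ⁻¹' K) (Prod.fst ⁻¹' Y) f h' a) ∨
      (G.rankGraph (S \ {a})).Reach (Prod.fst ⁻¹' K) (Prod.fst ⁻¹' Y) f h v := by
  have hanc : ∀ {v}, v ∈ (G.rankGraph S).Anc (Prod.fst ⁻¹' K) →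
      ∀ {h}, (G.rankGraph S).Reach (Prod.fst ⁻¹' K) (Prod.fst ⁻¹' Y) f h v →
      (∃ h', (G.rankGraph S).Reach (Prod.fst ⁻¹' K) (Prod.fst ⁻¹' Y) f h' a) ∨
      v ∈ (G.rankGraph (S \ {a})).Anc (Prod.fst ⁻¹' K) := by
    intro v hv
    induction hv using anc_induction with
    | base v hv => exact fun _ => Or.inr (mem_anc_of_mem hv)
    | step u v huv _ ih =>
      intro h hr
      by_cases huK : u ∈ Prod.fst ⁻¹' K
      · exact Or.inr (mem_anc_of_mem huK)
      by_cases hu : u = a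
      · exact Or.inl ⟨h, hu ▸ hr⟩
      have hr' := hr.fwd huK huv
      by_cases hv : v = a
      · exact Or.inl ⟨_, hv ▸ hr'⟩
      exact (ih hr').imp id fun hv' =>
        mem_anc_of_dir ⟨huv.1, huv.2.1, ⟨huv.2.2.1, hu⟩, huv.2.2.2, hv⟩ hv'
  induction hr with
  | start hv => exact Or.inr (Reach.start hv)
  | @step h u v k hr hp hk ih =>
    by_cases hu : u = a
    · exact Or.inl ⟨h, hu ▸ hr⟩
    by_cases hv : v = a
    · exact Or.inl ⟨_, hv ▸ hr.step k hp hk⟩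
    rcases ih with ih | ih
    · exact Or.inl ih
    have hp' : (∃ h', (G.rankGraph S).Reach (Prod.fst ⁻¹' K) (Prod.fst ⁻¹' Y) f h' a) ∨
        (G.rankGraph (S \ {a})).Passable (Prod.fst ⁻¹' K) h k.headAtSource u := by
      by_cases hA : u ∈ (G.rankGraph S).Anc (Prod.fst ⁻¹' K)
      · exact (hanc hA hr).imp id fun hA' => hp.imp (fun _ => hA') id
      · exact Or.inr (hp.imp (fun h => absurd h hA) id)
    refine hp'.imp id fun hp' => ih.step k hp' ?_
    cases k
    · exact ⟨hk.1, hk.2.1, ⟨hk.2.2.1, hu⟩, hk.2.2.2, hv⟩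
    · exact ⟨hk.1, hk.2.1, ⟨hk.2.2.1, hv⟩, hk.2.2.2, hu⟩
    · exact ⟨hk.1, ⟨hk.2.1, hu⟩, hk.2.2, hv⟩

/-- An active walk either avoids the non-ancestor `b` or passes through it. -/
lemma Reach.passes_or_diff (hb : b ∉ (G.rankGraph S).Anc (Prod.fst ⁻¹' K))
    (hr : (G.rankGraph S).Reach (Prod.fst ⁻¹' K) (Prod.fst ⁻¹' Y) f h v) :
    ∀ {h'}, (G.rankGraph S).Reach (Prod.fst ⁻¹' K) (Prod.fst ⁻¹' X) g h' v →
      (G.rankGraph S).Passable (Prod.fst ⁻¹' K) h h' v →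
      (∃ h h', (G.rankGraph S).Reach (Prod.fst ⁻¹' K) (Prod.fst ⁻¹' Y) f h b ∧
        (G.rankGraph S).Reach (Prod.fst ⁻¹' K) (Prod.fst ⁻¹' X) g h' b ∧
        (G.rankGraph S).Passable (Prod.fst ⁻¹' K) h h' b) ∨
      (v ≠ b ∧ (G.rankGraph (S \ {b})).Reach (Prod.fst ⁻¹' K) (Prod.fst ⁻¹' Y) f h v) := by
  induction hr with
  | @start v hv =>
    intro h' hX hp
    by_cases hvb : v = b
    · subst hvb
      exact Or.inl ⟨_, _, Reach.start hv, hX, hp⟩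
    · exact Or.inr ⟨hvb, Reach.start hv⟩
  | @step h u v k hr hp hk ih =>
    intro h' hX hp'
    by_cases hvb : v = b
    · subst hvb
      exact Or.inl ⟨_, _, hr.step k hp hk, hX, hp'⟩
    refine (ih (hX.step_back hp' hk) hp).imp id fun ⟨hub, hu⟩ => ⟨hvb, hu.step k
      (hp.imp (mem_anc_diff_of_not_mem_anc hb) id) ?_⟩
    cases k
    · exact ⟨hk.1, hk.2.1, ⟨hk.2.2.1, hub⟩, hk.2.2.2, hvb⟩
    · exact ⟨hk.1, hk.2.1, ⟨hk.2.2.1, hvb⟩, hk.2.2.2, hub⟩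
    · exact ⟨hk.1, ⟨hk.2.1, hub⟩, hk.2.2, hvb⟩

/-- A walk to `b` can be cut at its first visit of `b`, and if it enters `b` there otherwise than
by `→`, then it reaches the lower vertex `a` of the same cluster instead. -/
lemma Reach.exists_lower_or_dir (hb : b ∉ (G.rankGraph S).Anc (Prod.fst ⁻¹' K)) (ha : a ∈ S)
    (hab : a.1 = b.1) (hlt : a.2 < b.2)
    (hr : (G.rankGraph S).Reach (Prod.fst ⁻¹' K) (Prod.fst ⁻¹' Y) f h v) :
    (v ≠ b ∧ (G.rankGraph (S \ {b})).Reach (Prod.fst ⁻¹' K) (Prod.fst ⁻¹' Y) f h v) ∨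
    (∃ h', (G.rankGraph (S \ {b})).Reach (Prod.fst ⁻¹' K) (Prod.fst ⁻¹' Y) f h' a) ∨
    (∃ h' u, (G.rankGraph (S \ {b})).Reach (Prod.fst ⁻¹' K) (Prod.fst ⁻¹' Y) f h' u ∧
      u ∉ Prod.fst ⁻¹' K ∧ (G.rankGraph S).dir u b) := by
  have haS : a ∈ S \ {b} := ⟨ha, by rintro rfl; exact lt_irrefl _ hlt⟩
  induction hr with
  | @start v hv =>
    by_cases hvb : v = b
    · subst hvb
      exact Or.inr (Or.inl ⟨_, Reach.start (by simpa [hab] using hv)⟩)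
    · exact Or.inl ⟨hvb, Reach.start hv⟩
  | @step h u v k _ hp hk ih =>
    refine ih.elim (fun ⟨hub, hu⟩ => ?_) Or.inr
    have hp' : (G.rankGraph (S \ {b})).Passable (Prod.fst ⁻¹' K) h k.headAtSource u :=
      hp.imp (mem_anc_diff_of_not_mem_anc hb) id
    by_cases hvb : v = b
    · subst hvb
      right
      cases k
      · exact Or.inr ⟨h, u, hu, passable_false_right.1 hp, hk⟩
      · exact Or.inl ⟨_, hu.bwd hp' (rankGraph_dir_of_le hk hab rfl hlt.le le_rfl haS
          ⟨hk.2.2.2, hub⟩)⟩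
      · exact Or.inl ⟨_, hu.bidir hp' (rankGraph_bi_of_eq hk rfl hab ⟨hk.2.1, hub⟩ haS)⟩
    · refine Or.inl ⟨hvb, hu.step k hp' ?_⟩
      cases k
      · exact ⟨hk.1, hk.2.1, ⟨hk.2.2.1, hub⟩, hk.2.2.2, hvb⟩
      · exact ⟨hk.1, hk.2.1, ⟨hk.2.2.1, hvb⟩, hk.2.2.2, hub⟩
      · exact ⟨hk.1, ⟨hk.2.1, hub⟩, hk.2.2, hvb⟩

/-- Let an active walk reach the non-ancestor `b` and go on to `X` along a directed path. If the
lower vertex `a` of the same cluster can be reached without `b`, then the path can be entered from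
`a`; otherwise the walk does not need `a`. -/
lemma linked_diff_of_reach (hb : b ∉ (G.rankGraph S).Anc (Prod.fst ⁻¹' K)) (ha : a ∈ S)
    (hbS : b ∈ S) (hab : a.1 = b.1) (hlt : a.2 < b.2)
    (hY : (G.rankGraph S).Reach (Prod.fst ⁻¹' K) (Prod.fst ⁻¹' Y) f h b)
    (hX : (G.rankGraph S).Reach (Prod.fst ⁻¹' K) (Prod.fst ⁻¹' X) g false b) :
    (G.rankGraph (S \ {a})).Linked (Prod.fst ⁻¹' K) (Prod.fst ⁻¹' Y) f (Prod.fst ⁻¹' X) g ∨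
      (G.rankGraph (S \ {b})).Linked (Prod.fst ⁻¹' K) (Prod.fst ⁻¹' Y) f (Prod.fst ⁻¹' X) g := by
  have hbK : b ∉ Prod.fst ⁻¹' K := fun h => hb (mem_anc_of_mem h)
  have hne : a ≠ b := by rintro rfl; exact lt_irrefl _ hlt
  have hX' := (hX.start_lower hb).2
  have hvisit : ∀ {h'}, (G.rankGraph (S \ {b})).Reach (Prod.fst ⁻¹' K) (Prod.fst ⁻¹' Y) f h' a →
      (G.rankGraph (S \ {b})).Linked (Prod.fst ⁻¹' K) (Prod.fst ⁻¹' Y) f (Prod.fst ⁻¹' X) g := by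
    intro h' hr
    refine linked_of_reach (hX' (S \ {b}) (fun w hw hbw => ⟨hw, ?_⟩) a ⟨ha, hne⟩ hab hlt.le) hr
      (passable_false_right.2 (by simpa [hab] using hbK))
    rintro rfl
    exact lt_irrefl _ hbw
  rcases hY.exists_lower_or_dir hb ha hab hlt with h | ⟨h', hr⟩ | ⟨h', u, hr, huK, hub⟩
  · exact absurd rfl h.1
  · exact Or.inr (hvisit hr)
  · by_cases hua : u = a
    · exact Or.inr (hvisit (hua ▸ hr))
    rcases hr.exists_or_diff a with ⟨h'', hr'⟩ | hr'
    · exact Or.inr (hvisit hr')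
    · left
      have hr'' := (hr'.rankGraph_mono (S' := S \ {a})
        (Set.sdiff_subset_sdiff_left Set.sdiff_subset)).fwd huK
        ⟨hub.1, hub.2.1, ⟨hub.2.2.1, hua⟩, hbS, hne.symm⟩
      refine linked_of_reach (hX' (S \ {a}) (fun w hw hbw => ⟨hw, ?_⟩) b ⟨hbS, hne.symm⟩ rfl le_rfl)
        hr'' (passable_false_right.2 hbK)
      rintro rfl
      exact lt_asymm hlt hbw

/-- Among the vertices of a cluster, every pair that has a lower vertex in the cluster contains a
dispensable one. -/
lemma linked_diff_or_linked_diff (hm : m ∈ S) (ha : a ∈ S) (hb : b ∈ S) (hma : m.1 = a.1)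
    (hab : a.1 = b.1) (hlma : m.2 < a.2) (hlab : a.2 < b.2)
    (hl : (G.rankGraph S).Linked (Prod.fst ⁻¹' K) (Prod.fst ⁻¹' Y) f (Prod.fst ⁻¹' X) g) :
    (G.rankGraph (S \ {a})).Linked (Prod.fst ⁻¹' K) (Prod.fst ⁻¹' Y) f (Prod.fst ⁻¹' X) g ∨
      (G.rankGraph (S \ {b})).Linked (Prod.fst ⁻¹' K) (Prod.fst ⁻¹' Y) f (Prod.fst ⁻¹' X) g := by
  by_cases hbK : b ∈ (G.rankGraph S).Anc (Prod.fst ⁻¹' K)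
  · exact Or.inl (linked_diff_of_mem_anc hm hb hma hab.symm hlma hlab hbK hl)
  obtain ⟨h, x, hx, hr, hp⟩ := hl
  rcases hr.passes_or_diff hbK (Reach.start hx) hp with ⟨h, h', hY, hX, hp⟩ | ⟨-, hr'⟩
  · cases h'
    · exact linked_diff_of_reach hbK ha hb hab hlab hY hX
    · obtain rfl := hp.of_not_mem_anc hbK
      exact (linked_diff_of_reach hbK ha hb hab hlab hX hY).imp Linked.symm Linked.symm
  · exact Or.inr ⟨h, x, hx, hr', hp.imp (mem_anc_diff_of_not_mem_anc hbK) id⟩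

end MixedGraph

/-! ### Reduction to three ranks in each cluster -/

namespace MixedGraph

variable {C V : Type*}

lemma IsADMG.exists_rank [Finite V] {M : MixedGraph V} (hM : M.IsADMG) :
    ∃ r : V → ℕ, ∀ u v, M.dir u v → r u < r v := by
  refine ⟨fun v => {u | Relation.TransGen M.dir u v}.ncard, fun u v huv => ?_⟩
  refine Set.ncard_lt_ncard ⟨fun w hw => Relation.TransGen.tail hw huv, fun h => ?_⟩
    (Set.toFinite _)
  exact hM.1 u (h (Relation.TransGen.single huv))

/-- The set `S` of pairs (cluster, rank) contains every cluster, and ranks realizing every directed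
edge between clusters. -/
def Realizes (S : Set (C × ℕ)) (G : MixedGraph C) : Prop :=
  (∀ c, ∃ r, (c, r) ∈ S) ∧
    ∀ c d, G.dir c d → ∃ r s, (c, r) ∈ S ∧ (d, s) ∈ S ∧ r < s

lemma Realizes.diff {S : Set (C × ℕ)} {G : MixedGraph C} (hS : Realizes S G) {c : C} {m a l : ℕ}
    (hm : (c, m) ∈ S) (hl : (c, l) ∈ S) (hma : m < a) (hal : a < l) :
    Realizes (S \ {(c, a)}) G := by
  have lower : ∀ {d r}, (d, r) ∈ S → ∃ s, (d, s) ∈ S \ {(c, a)} ∧ s ≤ r := by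
    intro d r hr
    by_cases h : (d, r) = (c, a)
    · obtain ⟨rfl, rfl⟩ := Prod.mk.inj h
      exact ⟨m, ⟨hm, by simpa using hma.ne⟩, hma.le⟩
    · exact ⟨r, ⟨hr, h⟩, le_rfl⟩
  have upper : ∀ {d r}, (d, r) ∈ S → ∃ s, (d, s) ∈ S \ {(c, a)} ∧ r ≤ s := by
    intro d r hr
    by_cases h : (d, r) = (c, a)
    · obtain ⟨rfl, rfl⟩ := Prod.mk.inj h
      exact ⟨l, ⟨hl, by simpa using hal.ne'⟩, hal.le⟩
    · exact ⟨r, ⟨hr, h⟩, le_rfl⟩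
  refine ⟨fun d => ?_, fun d e hde => ?_⟩
  · obtain ⟨r, hr⟩ := hS.1 d
    obtain ⟨s, hs, -⟩ := lower hr
    exact ⟨s, hs⟩
  · obtain ⟨r, s, hr, hs, hrs⟩ := hS.2 d e hde
    obtain ⟨r', hr', hle⟩ := lower hr
    obtain ⟨s', hs', hle'⟩ := upper hs
    exact ⟨r', s', hr', hs', (hle.trans_lt hrs).trans_le hle'⟩

/-- Deleting dispensable vertices other than the lowest and the highest of a cluster leaves at most
three ranks in each cluster. -/
lemma exists_subset_ncard_le_three {G H : MixedGraph C} {K X Y : Set C} {f g : Bool}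
    {S : Set (C × ℕ)} (hfin : S.Finite) (hS : Realizes S G)
    (hl : (H.rankGraph S).Linked (Prod.fst ⁻¹' K) (Prod.fst ⁻¹' Y) f (Prod.fst ⁻¹' X) g) :
    ∃ T ⊆ S, Realizes T G ∧
      (H.rankGraph T).Linked (Prod.fst ⁻¹' K) (Prod.fst ⁻¹' Y) f (Prod.fst ⁻¹' X) g ∧
      ∀ c, (Prod.mk c ⁻¹' T).ncard ≤ 3 := by
  induction hn : S.ncard using Nat.strong_induction_on generalizing S with
  | _ n ih =>
    by_cases h3 : ∀ c, (Prod.mk c ⁻¹' S).ncard ≤ 3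
    · exact ⟨S, subset_rfl, hS, hl, h3⟩
    push Not at h3
    obtain ⟨c, hc⟩ := h3
    have hcfin : (Prod.mk c ⁻¹' S).Finite := hfin.preimage (Prod.mk_right_injective c).injOn
    rw [Set.ncard_eq_toFinset_card _ hcfin] at hc
    let e := Finset.orderEmbOfCardLe _ hc
    have he : ∀ i, (c, e i) ∈ S := fun i => by
      simpa using Finset.orderEmbOfCardLe_mem _ hc i
    have hlt : ∀ {i j}, i < j → e i < e j := fun h => e.strictMono h
    have hdel : ∀ i, 0 < i → i < 3 →
        (H.rankGraph (S \ {(c, e i)})).Linked (Prod.fst ⁻¹' K) (Prod.fst ⁻¹' Y) f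
          (Prod.fst ⁻¹' X) g →
        ∃ T ⊆ S, Realizes T G ∧
          (H.rankGraph T).Linked (Prod.fst ⁻¹' K) (Prod.fst ⁻¹' Y) f (Prod.fst ⁻¹' X) g ∧
          ∀ c, (Prod.mk c ⁻¹' T).ncard ≤ 3 := by
      intro i h0 h3 hl'
      obtain ⟨T, hT, h⟩ := ih _ (hn ▸ Set.ncard_sdiff_singleton_lt_of_mem (he i) hfin)
        (hfin.subset Set.sdiff_subset) (hS.diff (he 0) (he 3) (hlt h0) (hlt h3)) hl' rfl
      exact ⟨T, hT.trans Set.sdiff_subset, h⟩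
    have h01 := hlt (show (0 : Fin 4) < 1 by decide)
    have h12 := hlt (show (1 : Fin 4) < 2 by decide)
    rcases linked_diff_or_linked_diff (he 0) (he 1) (he 2) rfl rfl h01 h12 hl with h | h
    · exact hdel 1 (by decide) (by decide) h
    · exact hdel 2 (by decide) (by decide) h

end MixedGraph

/-! ### Compatible graphs on micro-variables -/

namespace ClusterGraph

open MixedGraph

variable {C : Type*} {G : ClusterGraph C}

/-- The graph on the micro-variables with all directed edges that the cluster graph allows and that
increase a given rank, and with all bidirected edges, loops included, that it allows. -/
def microGraph (G : ClusterGraph C) (e : G.Micro → ℕ) : MixedGraph G.Micro where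
  dir u v := G.dir u.1 v.1 ∧ e u < e v
  bi u v := G.bi u.1 v.1
  bi_symm _ _ h := G.bi_symm _ _ h

lemma compatible_loopless_microGraph {e : G.Micro → ℕ}
    (hdir : ∀ c d, G.dir c d → ∃ i j, e ⟨c, i⟩ < e ⟨d, j⟩) (hbi : ∀ c, G.bi c c → 1 < G.size c) :
    G.Compatible (G.microGraph e).loopless := by
  refine ⟨⟨fun v hv => ?_, fun v hv => hv.2 rfl⟩, fun c d => ⟨fun h => ?_, ?_⟩,
    fun c d => ⟨fun h => ?_, ?_⟩⟩
  · have : Relation.TransGen (· < ·) (e v) (e v) := hv.lift e fun _ _ h => h.2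
    rw [Relation.transGen_eq_self] at this
    exact lt_irrefl _ this
  · obtain ⟨i, j, hij⟩ := hdir c d h
    exact ⟨i, j, h, hij⟩
  · rintro ⟨i, j, h⟩
    exact h.1
  · by_cases hcd : c = d
    · subst hcd
      have hc := hbi c h
      exact ⟨⟨0, by omega⟩, ⟨1, hc⟩, h, by simp⟩
    · exact ⟨⟨0, G.size_pos c⟩, ⟨0, G.size_pos d⟩, h, fun h' => hcd (congrArg Sigma.fst h')⟩
  · rintro ⟨i, j, h⟩
    exact h.1

/-- The inclusion of the micro-variables of the reduced cluster graph. -/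
def shrinkIncl (G : ClusterGraph C) (v : G.shrink.Micro) : G.Micro :=
  ⟨v.1, Fin.castLE (min_le_left _ _) v.2⟩

lemma shrinkIncl_injective : Function.Injective G.shrinkIncl := by
  rintro ⟨c, i⟩ ⟨d, j⟩ h
  obtain rfl : c = d := congrArg Sigma.fst h
  have := eq_of_heq (Sigma.mk.inj h).2
  exact congrArg (Sigma.mk c) (Fin.castLE_inj.1 this)

/-- The graph on the micro-variables that has the edges of a graph on the micro-variables of the
reduced cluster graph, the other micro-variables being isolated. -/
def extend (M : MixedGraph G.shrink.Micro) : MixedGraph G.Micro where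
  dir u v := ∃ u' v', G.shrinkIncl u' = u ∧ G.shrinkIncl v' = v ∧ M.dir u' v'
  bi u v := ∃ u' v', G.shrinkIncl u' = u ∧ G.shrinkIncl v' = v ∧ M.bi u' v'
  bi_symm := fun _ _ ⟨u', v', hu, hv, h⟩ => ⟨v', u', hv, hu, M.bi_symm _ _ h⟩

lemma compatible_extend {M : MixedGraph G.shrink.Micro} (hM : G.shrink.Compatible M) :
    G.Compatible (extend M) := by
  refine ⟨⟨fun v hv => ?_, ?_⟩, fun c d => ⟨fun h => ?_, ?_⟩, fun c d => ⟨fun h => ?_, ?_⟩⟩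
  · have key : ∀ {u v}, Relation.TransGen (extend M).dir u v →
        ∃ u' v', G.shrinkIncl u' = u ∧ G.shrinkIncl v' = v ∧ Relation.TransGen M.dir u' v' := by
      intro u v h
      induction h with
      | single h =>
        obtain ⟨u', v', hu, hv, h⟩ := h
        exact ⟨u', v', hu, hv, .single h⟩
      | tail _ h ih =>
        obtain ⟨u', v', hu, hv, huv⟩ := ih
        obtain ⟨v'', w', hv', hw, hvw⟩ := h
        obtain rfl := shrinkIncl_injective (hv.trans hv'.symm)
        exact ⟨u', w', hu, hw, huv.tail hvw⟩
    obtain ⟨u', v', hu, hv, h⟩ := key hv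
    obtain rfl := shrinkIncl_injective (hu.trans hv.symm)
    exact hM.1.1 _ h
  · rintro v ⟨u', v', hu, hv, h⟩
    obtain rfl := shrinkIncl_injective (hu.trans hv.symm)
    exact hM.1.2 _ h
  · obtain ⟨i, j, hij⟩ := (hM.2.1 c d).1 h
    exact ⟨_, _, ⟨c, i⟩, ⟨d, j⟩, rfl, rfl, hij⟩
  · rintro ⟨i, j, ⟨c', i'⟩, ⟨d', j'⟩, hu, hv, h⟩
    obtain rfl : c' = c := congrArg Sigma.fst hu
    obtain rfl : d' = d := congrArg Sigma.fst hv
    exact (hM.2.1 c' d').2 ⟨_, _, h⟩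
  · obtain ⟨i, j, hij⟩ := (hM.2.2 c d).1 h
    exact ⟨_, _, ⟨c, i⟩, ⟨d, j⟩, rfl, rfl, hij⟩
  · rintro ⟨i, j, ⟨c', i'⟩, ⟨d', j'⟩, hu, hv, h⟩
    obtain rfl : c' = c := congrArg Sigma.fst hu
    obtain rfl : d' = d := congrArg Sigma.fst hv
    exact (hM.2.2 c' d').2 ⟨_, _, h⟩

lemma Compatible.one_lt_size {M : MixedGraph G.Micro} (hM : G.Compatible M) {c : C}
    (hc : G.bi c c) : 1 < G.size c := by
  obtain ⟨i, j, hij⟩ := (hM.2.2 c c).1 hc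
  by_contra h
  have : i = j := Fin.ext (by omega)
  exact hM.1.2 _ (this ▸ hij)

/-- A set with at most as many ranks per cluster as the cluster has micro-variables is the set of
ranks of micro-variables. -/
lemma exists_rank_of_ncard_le {S : Set (C × ℕ)} (hfin : S.Finite) (hne : ∀ c, ∃ r, (c, r) ∈ S)
    (hcard : ∀ c, (Prod.mk c ⁻¹' S).ncard ≤ G.size c) :
    ∃ (e : G.Micro → ℕ) (φ : C × ℕ → G.Micro),
      (∀ v, (φ v).1 = v.1) ∧ ∀ v ∈ S, e (φ v) = v.2 := by
  have : ∀ c, ∃ (e : Fin (G.size c) → ℕ) (φ : ℕ → Fin (G.size c)),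
      ∀ r, (c, r) ∈ S → e (φ r) = r := by
    intro c
    have hcfin : (Prod.mk c ⁻¹' S).Finite := hfin.preimage (Prod.mk_right_injective c).injOn
    have := hcfin.fintype
    have hle : Fintype.card (Prod.mk c ⁻¹' S) ≤ Fintype.card (Fin (G.size c)) := by
      rw [Fintype.card_fin, ← Nat.card_eq_fintype_card, Nat.card_coe_set_eq]
      exact hcard c
    obtain ⟨φ⟩ := Function.Embedding.nonempty_of_card_le hle
    obtain ⟨r, hr⟩ := hne c
    have : Nonempty (Prod.mk c ⁻¹' S) := ⟨⟨r, hr⟩⟩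
    classical
    refine ⟨fun i => (Function.invFun φ i).1,
      fun r => if h : (c, r) ∈ S then φ ⟨r, h⟩ else ⟨0, G.size_pos c⟩, fun r hr => ?_⟩
    simp [hr, Function.leftInverse_invFun φ.injective _]
  choose e φ h using this
  exact ⟨fun v => e v.1 v.2, fun v => ⟨v.1, φ v.1 v.2⟩, fun _ => rfl, fun v hv => h _ _ hv⟩

end ClusterGraph

lemma disjoint_microSet {C : Type*} {G : ClusterGraph C} {A B : Set C} (h : Disjoint A B) :
    Disjoint (G.microSet A) (G.microSet B) :=
  h.preimage Sigma.fst

open MixedGraph ClusterGraph in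
/-- Ranks from a topological order turn `M` into a graph of clusters and ranks, in which each
cluster can be reduced to three ranks. -/
lemma ClusterGraph.Compatible.exists_shrink {C : Type*} [Finite C] {G : ClusterGraph C}
    {W X Y Z : Set C} (hWX : Disjoint W X) (hXZ : Disjoint X Z) {i : PearlRule}
    {M : MixedGraph G.Micro} (hM : G.Compatible M)
    (hn : ¬ i.Holds M (G.microSet W) (G.microSet X) (G.microSet Y) (G.microSet Z)) :
    ∃ M : MixedGraph G.shrink.Micro, G.shrink.Compatible M ∧
      ¬ i.Holds M (G.shrink.microSet W) (G.shrink.microSet X) (G.shrink.microSet Y)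
        (G.shrink.microSet Z) := by
  obtain ⟨r, hr⟩ := hM.1.exists_rank
  let ψ : G.Micro → C × ℕ := fun v => (v.1, r v)
  have hfin : (Set.range ψ).Finite := Set.finite_range ψ
  have hreal : Realizes (Set.range ψ) G.toMixedGraph := by
    refine ⟨fun c => ⟨_, ⟨c, 0, G.size_pos c⟩, rfl⟩, fun c d hcd => ?_⟩
    obtain ⟨i, j, hij⟩ := (hM.2.1 c d).1 hcd
    exact ⟨_, _, ⟨⟨c, i⟩, rfl⟩, ⟨⟨d, j⟩, rfl⟩, hr _ _ hij⟩
  have hn₁ := PearlRule.not_holds_map i (M' := G.rankGraph (Set.range ψ)) ψ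
    (fun u v huv => ⟨(hM.2.1 _ _).2 ⟨_, _, huv⟩, hr _ _ huv, ⟨u, rfl⟩, ⟨v, rfl⟩⟩)
    (fun u v huv => ⟨(hM.2.2 _ _).2 ⟨_, _, huv⟩, ⟨u, rfl⟩, ⟨v, rfl⟩⟩)
    (W := Prod.fst ⁻¹' W) (X := Prod.fst ⁻¹' X) (Y := Prod.fst ⁻¹' Y) (Z := Prod.fst ⁻¹' Z)
    (hWX.preimage _) (hXZ.preimage _) hn
  -- Mutilating the graph of clusters and ranks amounts to mutilating the graph on the clusters.
  have htails : i.tails (Prod.fst ⁻¹' X : Set (C × ℕ)) = Prod.fst ⁻¹' i.tails X := by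
    cases i <;> rfl
  have hmut : ∀ S : Set (C × ℕ), (G.rankGraph S).mutilate (Prod.fst ⁻¹' W)
      (i.tails (Prod.fst ⁻¹' X)) = (G.mutilate W (i.tails X)).rankGraph S := by
    intro S
    rw [htails]
    simp only [mutilate, rankGraph, MixedGraph.mk.injEq]
    constructor <;> ext u v <;> simp only [Set.mem_preimage] <;> tauto
  rw [PearlRule.not_holds_iff i (hWX.preimage _) (hXZ.preimage _), hmut,
    ← Set.preimage_union] at hn₁
  obtain ⟨S, hS, hSreal, hSl, hS3⟩ := exists_subset_ncard_le_three hfin hreal hn₁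
  rw [← hmut, Set.preimage_union,
    ← PearlRule.not_holds_iff i (hWX.preimage _) (hXZ.preimage _)] at hSl
  have hcard : ∀ c, (Prod.mk c ⁻¹' S).ncard ≤ G.shrink.size c := by
    intro c
    refine le_min ?_ (hS3 c)
    have hsub : Prod.mk c ⁻¹' S ⊆ Set.range fun i : Fin (G.size c) => r ⟨c, i⟩ := by
      intro s hs
      obtain ⟨⟨d, j⟩, hj⟩ := hS hs
      obtain ⟨rfl, rfl⟩ := Prod.mk.inj hj
      exact ⟨j, rfl⟩
    refine (Set.ncard_le_ncard hsub (Set.finite_range _)).trans ?_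
    rw [← Set.image_univ]
    refine (Set.ncard_image_le Set.finite_univ).trans ?_
    simp [Set.ncard_univ]
  obtain ⟨e, φ, hφ, he⟩ := exists_rank_of_ncard_le (G := G.shrink) (hfin.subset hS) hSreal.1 hcard
  refine ⟨(G.shrink.microGraph e).loopless, compatible_loopless_microGraph ?_ ?_, fun h => ?_⟩
  · intro c d hcd
    obtain ⟨s, t, hs, ht, hst⟩ := hSreal.2 c d hcd
    obtain ⟨c', j, hj⟩ : ∃ c' j, φ (c, s) = ⟨c', j⟩ := ⟨_, _, rfl⟩
    obtain ⟨d', k, hk⟩ : ∃ d' k, φ (d, t) = ⟨d', k⟩ := ⟨_, _, rfl⟩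
    obtain rfl : c' = c := (congrArg Sigma.fst hj).symm.trans (hφ _)
    obtain rfl : d' = d := (congrArg Sigma.fst hk).symm.trans (hφ _)
    exact ⟨j, k, by rw [← hj, ← hk, he _ hs, he _ ht]; exact hst⟩
  · intro c hc
    exact lt_min (hM.one_lt_size hc) (by norm_num)
  · have hpre : ∀ A : Set C, φ ⁻¹' G.shrink.microSet A = Prod.fst ⁻¹' A := by
      intro A
      ext v
      simp [microSet, hφ]
    refine PearlRule.not_holds_map i (M := G.rankGraph S) (M' := G.shrink.microGraph e) φ ?_ ?_
      (disjoint_microSet hWX) (disjoint_microSet hXZ) ?_ (PearlRule.holds_of_loopless i h)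
    · rintro u v ⟨huv, hlt, hu, hv⟩
      refine ⟨?_, by rwa [he _ hu, he _ hv]⟩
      rw [hφ, hφ]
      exact huv
    · rintro u v ⟨huv, -, -⟩
      change G.bi (φ u).1 (φ v).1
      rw [hφ, hφ]
      exact huv
    · simpa only [hpre] using hSl

theorem theorem4 {C : Type*} [Finite C] (G : ClusterGraph C) (hG : G.IsCDAG)
    (W X Y Z : Set C)
    (hWX : Disjoint W X) (hWY : Disjoint W Y) (hWZ : Disjoint W Z)
    (hXY : Disjoint X Y) (hXZ : Disjoint X Z) (hYZ : Disjoint Y Z)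
    (i : PearlRule) :
    (∃ M : MixedGraph G.Micro, G.Compatible M ∧
        ¬ i.Holds M (G.microSet W) (G.microSet X) (G.microSet Y) (G.microSet Z)) ↔
      (∃ M : MixedGraph G.shrink.Micro, G.shrink.Compatible M ∧
        ¬ i.Holds M (G.shrink.microSet W) (G.shrink.microSet X) (G.shrink.microSet Y)
          (G.shrink.microSet Z)) := by
  constructor
  · rintro ⟨M, hM, hn⟩
    exact hM.exists_shrink hWX hXZ hn
  · rintro ⟨M, hM, hn⟩
    refine ⟨ClusterGraph.extend M, ClusterGraph.compatible_extend hM, ?_⟩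
    exact PearlRule.not_holds_map i (M' := ClusterGraph.extend M) G.shrinkIncl
      (fun u v h => ⟨u, v, rfl, rfl, h⟩)
      (fun u v h => ⟨u, v, rfl, rfl, h⟩) (disjoint_microSet hWX) (disjoint_microSet hXZ) hn
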